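/- Let $m\ge 1$ and write $u\cdot w^\dagger=\sum_i u_i\overline{w_i}$ on $\mathbb C^m$; let $S\subset\mathbb C^m$ be the set of unit vectors. A soliton of the Manakov model $\mathrm i\,q_t+q_{xx}+2\|q\|^2q=0$ carries a parameter $\zeta\in\mathbb C$ with $\operatorname{Im}\zeta>0$ (its velocity is $-4\operatorname{Re}\zeta$) and a polarization in $S$. For $\zeta_1\neq\zeta_2$ in the upper half-plane, the two-soliton polarization map $R(\zeta_2,\zeta_1):(v,u_1)\mapsto(u_2,w)$, for a soliton 2 of initial polarization $v$ overtaking a soliton 1 of initial polarization $u_1$, is given by $$e^{-2\phi}=\left|\frac{\zeta_1-\zeta_2}{\zeta_1-\zeta_2^*}\right|^2\left\{1-\frac{(\zeta_1-\zeta_1^*)(\zeta_2-\zeta_2^*)}{|\zeta_1-\zeta_2|^2}\,|u_1\cdot v^\dagger|^2\right\}^{-1},\quad \phi\in\mathbb R,$$ $$u_2=e^{-\phi}\,\frac{\zeta_1-\zeta_2^*}{\zeta_1^*-\zeta_2^*}\left\{v+\frac{\zeta_1-\zeta_1^*}{\zeta_1^*-\zeta_2^*}(v\cdot u_1^\dagger)\,u_1\right\},\qquad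 w=e^{-\phi}\,\frac{\zeta_2^*-\zeta_1}{\zeta_2-\zeta_1}\left\{u_1-\frac{\zeta_2-\zeta_2^*}{\zeta_2-\zeta_1}(u_1\cdot v^\dagger)\,v\right\}.$$ 1. $R(\zeta_2,\zeta_1)$ maps $S\times S$ into $S\times S$, and it is the passage from initial to final polarizations in the two-soliton collision law: for $v,u_1,u_2\in S$ and $w\in\mathbb C^m$, $R(\zeta_2,\zeta_1)(v,u_1)=(u_2,w)$ if and only if $v=D(\zeta_1,\zeta_2;u_1,u_2)$ and $w=D(\zeta_2,\zeta_1;u_2,u_1)$, where $$D(\zeta_1,\zeta_2;u_1,u_2)=e^{\varphi}\,\frac{\zeta_1^*-\zeta_2^*}{\zeta_1-\zeta_2^*}\left\{u_2-\frac{\zeta_1-\zeta_1^*}{\zeta_1-\zeta_2^*}(u_2\cdot u_1^\dagger)\,u_1\right\},\quad e^{-2\varphi}=\left|\frac{\zeta_1-\zeta_2}{\zeta_1-\zeta_2^*}\right|^2\left\{1+\frac{(\zeta_1-\zeta_1^*)(\zeta_2-\zeta_2^*)}{|\zeta_1-\zeta_2^*|^2}|u_1\cdot u_2^\dagger|^2\right\},\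 \varphi\in\mathbb R.$$ 2. (Yang–Baxter equation.) For pairwise distinct $\zeta_0,\zeta_1,\zeta_2$ in the upper half-plane, let $R_{ij}$ be $R(\zeta_i,\zeta_j)$ acting on the components $i,j$ of $S^3$. Then $R_{01}\circ R_{02}\circ R_{12}=R_{12}\circ R_{02}\circ R_{01}$ on $S^3$. 3. Let $\zeta_1,\dots,\zeta_N$ lie in the upper half-plane with $\operatorname{Re}\zeta_1>\dots>\operatorname{Re}\zeta_N$, so that soliton $k$ is faster than soliton $j$ when $j<k$. The solitons are initially arranged on the line, from left to right, as $N,\dots,1$. In a pair collision a soliton $k$ overtakes its immediate right neighbour $j$, where $j<k$: the two exchange places, and their polarizations are changed by $R(\zeta_k,\zeta_j)$. An admissible order is a finite sequence of such pair collisions that leads to the final arrangement $1,\dots,N$. Every admissible order consists of $\binom N2$ pair collisions, and the composites of the collision maps along any two admissible orders are the same map on $S^N$. -/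

import Mathlib

open scoped ComplexConjugate

noncomputable section

namespace Manakov

/-- Polarization vectors live in `ℂ^m` with its Hermitian norm.  In the Hermitian product
`u · w† = ∑ i, u i * conj (w i)` the second vector is conjugated, so that it is `inner ℂ w u`. -/
abbrev Pol (m : ℕ) := EuclideanSpace ℂ (Fin m)

variable {m : ℕ}

/-- `e^{-2φ₁₂}` in terms of the bare polarizations `u₁, u₂`:
`|(ζ₁ - ζ₂)/(ζ₁ - ζ₂*)|² {1 + (ζ₁ - ζ₁*)(ζ₂ - ζ₂*)/|ζ₁ - ζ₂*|² |u₁ · u₂†|²}`,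
where `(ζ₁ - ζ₁*)(ζ₂ - ζ₂*) = -4 Im ζ₁ Im ζ₂`. -/
def bareShift (ζ₁ ζ₂ : ℂ) (u₁ u₂ : Pol m) : ℝ :=
  ‖(ζ₁ - ζ₂) / (ζ₁ - conj ζ₂)‖ ^ 2 *
    (1 + (-4 * ζ₁.im * ζ₂.im) / ‖ζ₁ - conj ζ₂‖ ^ 2 * ‖inner ℂ u₂ u₁‖ ^ 2)

/-- The collision law in terms of the bare polarizations:
`dressed ζ₁ ζ₂ u₁ u₂ = u_{{1},2}` is the polarization that soliton 2 has before it overtakes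
soliton 1 (and `dressed ζ₂ ζ₁ u₂ u₁ = u_{{2},1}` is the one that soliton 1 has afterwards);
`e^{φ₁₂}` is the inverse of the positive square root of `e^{-2φ₁₂}`. -/
def dressed (ζ₁ ζ₂ : ℂ) (u₁ u₂ : Pol m) : Pol m :=
  (((√(bareShift ζ₁ ζ₂ u₁ u₂))⁻¹ : ℝ) : ℂ) •
    ((conj ζ₁ - conj ζ₂) / (ζ₁ - conj ζ₂)) •
      (u₂ - ((ζ₁ - conj ζ₁) / (ζ₁ - conj ζ₂) * inner ℂ u₁ u₂) • u₁)

/-- `e^{-2φ₁₂}` in terms of the initial polarizations `v = u_{{1},2}` and `u₁`: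
`|(ζ₁ - ζ₂)/(ζ₁ - ζ₂*)|² {1 - (ζ₁ - ζ₁*)(ζ₂ - ζ₂*)/|ζ₁ - ζ₂|² |u₁ · v†|²}⁻¹`. -/
def initialShift (ζ₁ ζ₂ : ℂ) (u₁ v : Pol m) : ℝ :=
  ‖(ζ₁ - ζ₂) / (ζ₁ - conj ζ₂)‖ ^ 2 *
    (1 - (-4 * ζ₁.im * ζ₂.im) / ‖ζ₁ - ζ₂‖ ^ 2 * ‖inner ℂ v u₁‖ ^ 2)⁻¹

/-- The two-soliton polarization map `(u_{{1},2}, u₁) ↦ (u₂, u_{{2},1})` from the initial to the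
final polarizations of a collision in which soliton 2 (initially on the left) overtakes
soliton 1.  The parameter and the component of the overtaking soliton come first, both in the
argument and in the value. -/
def collisionMap (ζ₂ ζ₁ : ℂ) (p : Pol m × Pol m) : Pol m × Pol m :=
  let v := p.1
  let u₁ := p.2
  let r : ℂ := ((√(initialShift ζ₁ ζ₂ u₁ v) : ℝ) : ℂ)
  (r • ((ζ₁ - conj ζ₂) / (conj ζ₁ - conj ζ₂)) •
      (v + ((ζ₁ - conj ζ₁) / (conj ζ₁ - conj ζ₂) * inner ℂ u₁ v) • u₁),
    r • ((conj ζ₂ - ζ₁) / (ζ₂ - ζ₁)) •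
      (u₁ - ((ζ₂ - conj ζ₂) / (ζ₂ - ζ₁) * inner ℂ v u₁) • v))

/-- The set of unit vectors of `ℂ^m`. -/
def unitSphere (m : ℕ) : Set (Pol m) := {u | ‖u‖ = 1}

/-- The states of `N` solitons: component `n` is the (unit) polarization of soliton `n`. -/
def unitStates (N m : ℕ) : Set (Fin N → Pol m) := {x | ∀ n, x n ∈ unitSphere m}

/-- `R_{ij}`: the collision map with parameters `ζ i, ζ j` acting on the components `i` and `j`
of a state, where soliton `i` is the overtaking one. -/
def pairCollision {N : ℕ} (ζ : Fin N → ℂ) (i j : Fin N) (x : Fin N → Pol m) : Fin N → Pol m :=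
  Function.update
    (Function.update x i (collisionMap (ζ i) (ζ j) (x i, x j)).1)
    j (collisionMap (ζ i) (ζ j) (x i, x j)).2

/-- The composite of the collision maps of a list of pairs (overtaking, overtaken); the head of
the list collides first. -/
def composite {N : ℕ} (ζ : Fin N → ℂ) (w : List (Fin N × Fin N)) (x : Fin N → Pol m) :
    Fin N → Pol m :=
  w.foldl (fun y p => pairCollision ζ p.1 p.2 y) x

/-- `Collide a w b`: the arrangement `a` of solitons (listed from left to right) is turned into
the arrangement `b` by the successive pair collisions `w`, in each of which a soliton `k`
overtakes its immediate right neighbour `j`, where `j < k`, i.e. where `k` is faster than `j`. -/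
inductive Collide {N : ℕ} :
    List (Fin N) → List (Fin N × Fin N) → List (Fin N) → Prop
  | nil (a : List (Fin N)) : Collide a [] a
  | cons (l₁ l₂ : List (Fin N)) (j k : Fin N) (w : List (Fin N × Fin N)) (b : List (Fin N)) :
      j < k → Collide (l₁ ++ j :: k :: l₂) w b →
      Collide (l₁ ++ k :: j :: l₂) ((k, j) :: w) b

/-- An admissible order of pair collisions of `N` solitons, numbered by increasing velocity:
it leads from the initial arrangement (the fastest soliton leftmost) to the final one (the
fastest soliton rightmost). -/
def IsAdmissibleOrder (N : ℕ) (w : List (Fin N × Fin N)) : Prop :=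
  Collide (List.finRange N).reverse w (List.finRange N)

end Manakov

end

/-! A collision is an interchange of two linear polynomials in a spectral parameter. To a soliton
with parameter ζ and unit polarization u belongs the operator F(λ) = (ζ* - λ) + (ζ - ζ*) u u†, which
acts as ζ - λ on u and as ζ* - λ on the orthogonal complement. The polarizations before and after a
collision satisfy F₁(u₁) F₂(v) = F₂(u₂) F₁(w) for all λ (`factor_comm`). At λ = ζ₂* the image of
both sides is a line, which yields u₂ ∝ F₁(u₁) v; at λ = ζ₁* the adjoints yield w. The scalars in
the collision map are fixed constants times positive reals, and unit vectors that are positive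
multiples of each other are equal, so the shifts never have to be followed through a composition.

The collision law comes from inverting F₁(u₁), up to a scalar, by the factor with ζ₁ conjugated. In
the Yang–Baxter equation the polarizations of solitons 0 and 2 agree by one interchange each. The
middle one is read off from the triple product at λ = ζ₁*, where the factor of soliton 1 has rank
one (`IsCollision.yangBaxter`).

For N solitons a collision removes exactly one inversion of the arrangement, which gives the number
of collisions. Independence of the order is a confluence argument by induction on inversions
(`composite_eq`): two first collisions coincide, are disjoint and commute, or share a soliton, and
then the Yang–Baxter equation joins them. -/

noncomputable section

namespace Manakov

/-! ### Elementary factors and their interchange -/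

section Factor
variable {E : Type*} [NormedAddCommGroup E] [InnerProductSpace ℂ E]

/-- The elementary factor `(ζ* - lam) + (ζ - ζ*) u u†` applied to the vector `x`. -/
def factor (ζ : ℂ) (u : E) (lam : ℂ) (x : E) : E :=
  (conj ζ - lam) • x + ((ζ - conj ζ) * inner ℂ u x) • u

theorem factor_smul (ζ : ℂ) (u : E) (lam c : ℂ) (x : E) :
    factor ζ u lam (c • x) = c • factor ζ u lam x := by
  simp only [factor, inner_smul_right]
  module

theorem inner_factor_left (ζ : ℂ) (u : E) (lam : ℂ) (x y : E) :
    inner ℂ (factor ζ u lam x) y = inner ℂ x (factor (conj ζ) u (conj lam) y) := by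
  simp only [factor, inner_add_left, inner_add_right, inner_smul_left, inner_smul_right, map_sub,
    map_mul, Complex.conj_conj, inner_conj_symm]
  ring

/-- Conjugating ζ swaps the eigenvalues ζ - lam on u and ζ* - lam on its orthogonal complement, so
the product is scalar. -/
theorem factor_conj_factor {u : E} (hu : ‖u‖ = 1) (ζ lam : ℂ) (x : E) :
    factor (conj ζ) u lam (factor ζ u lam x) = ((ζ - lam) * (conj ζ - lam)) • x := by
  have h : inner ℂ u u = 1 := by simp [inner_self_eq_norm_sq_to_K, hu]
  simp only [factor, inner_add_right, inner_smul_right, Complex.conj_conj, h]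
  module

theorem factor_injective {u : E} (hu : ‖u‖ = 1) {ζ lam : ℂ} (h₁ : lam ≠ ζ) (h₂ : lam ≠ conj ζ) :
    Function.Injective (factor ζ u lam) := by
  intro x y h
  have h' := congrArg (factor (conj ζ) u lam) h
  rw [factor_conj_factor hu, factor_conj_factor hu] at h'
  exact smul_right_injective E
    (mul_ne_zero (sub_ne_zero.2 h₁.symm) (sub_ne_zero.2 h₂.symm)) h'

/-- At this value of the parameter the factor degenerates to rank at most one; polarizations are
extracted from operator identities here. -/
theorem factor_self_conj (ζ : ℂ) (u x : E) :
    factor ζ u (conj ζ) x = ((ζ - conj ζ) * inner ℂ u x) • u := by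
  simp [factor]

/-- Lets unit vectors be compared up to positive factors, which makes the exact values of the shifts
irrelevant in compositions. -/
theorem eq_of_pos_smul {x y : E} (hx : ‖x‖ = 1) (hy : ‖y‖ = 1) {c : ℝ} (hc : 0 < c)
    (h : x = (c : ℂ) • y) : x = y := by
  have : c = 1 := by
    have := congrArg norm h
    rw [norm_smul, hx, hy, Complex.norm_real, Real.norm_of_nonneg hc.le] at this
    linarith
  simpa [this] using h

/-- The common squared norm of the two unnormalized final polarizations. -/
def gram (ζ₁ ζ₂ : ℂ) (u v : E) : ℂ :=
  (ζ₁ - ζ₂) * (conj ζ₁ - conj ζ₂) -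
    (ζ₁ - conj ζ₁) * (ζ₂ - conj ζ₂) * (inner ℂ u v * inner ℂ v u)

variable {ζ₁ ζ₂ : ℂ} {u v : E}

theorem inner_factor_fast (hu : ‖u‖ = 1) (hv : ‖v‖ = 1) :
    inner ℂ (factor ζ₁ u (conj ζ₂) v) (factor ζ₁ u (conj ζ₂) v) = gram ζ₁ ζ₂ u v := by
  have h : inner ℂ u u = 1 := by simp [inner_self_eq_norm_sq_to_K, hu]
  have h' : inner ℂ v v = 1 := by simp [inner_self_eq_norm_sq_to_K, hv]
  simp only [factor, gram, inner_add_left, inner_add_right, inner_smul_left, inner_smul_right,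
    map_sub, map_mul, Complex.conj_conj, inner_conj_symm, h, h']
  ring

theorem inner_factor_slow (hu : ‖u‖ = 1) (hv : ‖v‖ = 1) :
    inner ℂ (factor (conj ζ₂) v ζ₁ u) (factor (conj ζ₂) v ζ₁ u) = gram ζ₁ ζ₂ u v := by
  have h : inner ℂ u u = 1 := by simp [inner_self_eq_norm_sq_to_K, hu]
  have h' : inner ℂ v v = 1 := by simp [inner_self_eq_norm_sq_to_K, hv]
  simp only [factor, gram, inner_add_left, inner_add_right, inner_smul_left, inner_smul_right,
    map_sub, map_mul, Complex.conj_conj, inner_conj_symm, h, h']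
  ring

/-- Interchange of two elementary factors. -/
theorem factor_comm (hu : ‖u‖ = 1) (hv : ‖v‖ = 1) (hg : gram ζ₁ ζ₂ u v ≠ 0) {b c : ℂ} {u₂ w : E}
    (hb : b * conj b * gram ζ₁ ζ₂ u v = 1) (hc : c * conj c * gram ζ₁ ζ₂ u v = 1)
    (hu₂ : u₂ = b • factor ζ₁ u (conj ζ₂) v) (hw : w = c • factor (conj ζ₂) v ζ₁ u)
    (lam : ℂ) (x : E) :
    factor ζ₁ u lam (factor ζ₂ v lam x) = factor ζ₂ u₂ lam (factor ζ₁ w lam x) := by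
  have h : inner ℂ u u = 1 := by simp [inner_self_eq_norm_sq_to_K, hu]
  have h' : inner ℂ v v = 1 := by simp [inner_self_eq_norm_sq_to_K, hv]
  -- The projector onto a normalized vector involves only |b|² = 1/gram, so the phases of b and c
  -- drop out.
  have key : ∀ (ζ b : ℂ) (y z : E), b * conj b * gram ζ₁ ζ₂ u v = 1 →
      factor ζ (b • y) lam z =
        (conj ζ - lam) • z + ((gram ζ₁ ζ₂ u v)⁻¹ * (ζ - conj ζ) * inner ℂ y z) • y := by
    intro ζ b y z hb
    have : (gram ζ₁ ζ₂ u v)⁻¹ = b * conj b := by field_simp; linear_combination -hb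
    rw [this]
    simp only [factor, inner_smul_left]
    module
  rw [hu₂, hw, key _ _ _ _ hb, key _ _ _ _ hc]
  generalize hG : (gram ζ₁ ζ₂ u v)⁻¹ = G
  have hG' : G * gram ζ₁ ζ₂ u v = 1 := by rw [← hG]; field_simp
  simp only [factor, inner_add_left, inner_add_right, inner_smul_left, inner_smul_right,
    map_sub, map_mul, Complex.conj_conj, inner_conj_symm, h, h', gram] at hG' ⊢
  generalize inner ℂ u v = a at *
  generalize inner ℂ v u = a' at *
  generalize inner ℂ u x = p at *
  generalize inner ℂ v x = q at *
  generalize conj ζ₁ = z₁ at *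
  generalize conj ζ₂ = z₂ at *
  -- Coefficients of x, v and u, in this order. The last two need G · gram = 1; since G occurs
  -- quadratically on the right, the multipliers themselves contain G.
  match_scalars
  · ring
  · linear_combination (-((z₁ - lam) * (ζ₂ - z₂) * q) + a' * G *
      ((ζ₂ - z₂) * (ζ₁ - z₁) * ((z₂ - z₁) * p + (ζ₂ - z₂) * a * q) * (z₁ - z₂))) * hG'
  · linear_combination (-((ζ₁ - z₁) * ((z₂ - lam) * p + (ζ₂ - z₂) * q * a)) + a' * G *
      ((ζ₂ - z₂) * (ζ₁ - z₁) * ((z₂ - z₁) * p + (ζ₂ - z₂) * a * q) * ((ζ₁ - z₁) * a))) * hG'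

end Factor

/-! ### The collision relation and its Yang–Baxter equation -/

section Relation
variable {E : Type*} [NormedAddCommGroup E] [InnerProductSpace ℂ E]

/-- The constant prefactor of the final polarization of the overtaking soliton. -/
def fastCoeff (ζ₂ ζ₁ : ℂ) : ℂ := (ζ₁ - conj ζ₂) / (conj ζ₁ - conj ζ₂) ^ 2

/-- The constant prefactor of the final polarization of the overtaken soliton. -/
def slowCoeff (ζ₂ ζ₁ : ℂ) : ℂ := (conj ζ₂ - ζ₁) / (ζ₂ - ζ₁) ^ 2

/-- The unit vectors `(v, u)` and `(u₂, w)` are the initial and the final polarizations of a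
collision in which soliton 2 overtakes soliton 1, up to positive factors. -/
structure IsCollision (ζ₂ ζ₁ : ℂ) (v u u₂ w : E) : Prop where
  ne : ζ₁ ≠ ζ₂
  ne_conj : ζ₁ ≠ conj ζ₂
  norm_v : ‖v‖ = 1
  norm_u : ‖u‖ = 1
  norm_u₂ : ‖u₂‖ = 1
  norm_w : ‖w‖ = 1
  exists_fast : ∃ r : ℝ, 0 < r ∧
    u₂ = (r * fastCoeff ζ₂ ζ₁ : ℂ) • factor ζ₁ u (conj ζ₂) v
  exists_slow : ∃ r : ℝ, 0 < r ∧
    w = (r * slowCoeff ζ₂ ζ₁ : ℂ) • factor (conj ζ₂) v ζ₁ u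
  factor_comm : ∀ (lam : ℂ) (x : E),
    factor ζ₁ u lam (factor ζ₂ v lam x) = factor ζ₂ u₂ lam (factor ζ₁ w lam x)

theorem fastCoeff_ne_zero {ζ₁ ζ₂ : ℂ} (h : ζ₁ ≠ ζ₂) (h' : ζ₁ ≠ conj ζ₂) :
    fastCoeff ζ₂ ζ₁ ≠ 0 := by
  have : conj ζ₁ ≠ conj ζ₂ := fun e => h ((starRingEnd ℂ).injective e)
  exact div_ne_zero (sub_ne_zero.2 h') (pow_ne_zero _ (sub_ne_zero.2 this))

theorem slowCoeff_ne_zero {ζ₁ ζ₂ : ℂ} (h : ζ₁ ≠ ζ₂) (h' : ζ₁ ≠ conj ζ₂) :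
    slowCoeff ζ₂ ζ₁ ≠ 0 :=
  div_ne_zero (sub_ne_zero.2 h'.symm) (pow_ne_zero _ (sub_ne_zero.2 h.symm))

/-- Taking adjoints reverses the products and conjugates all parameters. -/
theorem factor_comm_adjoint {ζ₁ ζ₂ lam : ℂ} {v u u₂ w : E}
    (h : ∀ x : E, factor ζ₁ u lam (factor ζ₂ v lam x) = factor ζ₂ u₂ lam (factor ζ₁ w lam x))
    (x : E) :
    factor (conj ζ₂) v (conj lam) (factor (conj ζ₁) u (conj lam) x) =
      factor (conj ζ₁) w (conj lam) (factor (conj ζ₂) u₂ (conj lam) x) := by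
  refine ext_inner_left ℂ fun y => ?_
  rw [← inner_factor_left, ← inner_factor_left, h, inner_factor_left, inner_factor_left]

namespace IsCollision
variable {ζ₁ ζ₂ : ℂ} {v u u₂ w : E}

theorem factor_comm_conj (h : IsCollision ζ₂ ζ₁ v u u₂ w) (lam : ℂ) (x : E) :
    factor (conj ζ₂) v lam (factor (conj ζ₁) u lam x) =
      factor (conj ζ₁) w lam (factor (conj ζ₂) u₂ lam x) := by
  simpa using factor_comm_adjoint (fun x => h.factor_comm (conj lam) x) x

/-- The initial polarization of the overtaken soliton in terms of the final ones. -/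
theorem exists_slow_inv (h : IsCollision ζ₂ ζ₁ v u u₂ w) (h₁ : ζ₁ ≠ conj ζ₁) :
    ∃ r : ℝ, 0 < r ∧ u = (r * conj (slowCoeff ζ₂ ζ₁) : ℂ) • factor ζ₂ u₂ (conj ζ₁) w := by
  obtain ⟨r, hr, hw⟩ := h.exists_slow
  refine ⟨r, hr, ?_⟩
  -- At ζ₁* both factors of soliton 1 have rank one, so the identity reads ⟨u, F₂(v) w⟩ u = ⟨w, w⟩
  -- F₂(u₂) w. The scalar on the left is found by moving F₂(v) onto u, which reproduces w.
  have h2 := h.factor_comm (conj ζ₁) w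
  have hww : inner ℂ w w = 1 := by simp [inner_self_eq_norm_sq_to_K, h.norm_w]
  rw [factor_self_conj, factor_self_conj, factor_smul, hww, mul_one, mul_smul] at h2
  have h3 := smul_right_injective E (sub_ne_zero.2 h₁) h2
  have h4 : (r * conj (slowCoeff ζ₂ ζ₁) : ℂ) * inner ℂ u (factor ζ₂ v (conj ζ₁) w) = 1 := by
    rw [← hww]
    nth_rewrite 2 [hw]
    have := inner_factor_left (conj ζ₂) v ζ₁ u w
    rw [Complex.conj_conj] at this
    rw [inner_smul_left, this]
    simp
  beta_reduce at h3
  rw [← h3, smul_smul, h4, one_smul]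

/-- The initial polarization of the overtaking soliton in terms of the final ones. -/
theorem exists_fast_inv (h : IsCollision ζ₂ ζ₁ v u u₂ w) (h₂ : ζ₂ ≠ conj ζ₂) :
    ∃ r : ℝ, 0 < r ∧ v = (r * conj (fastCoeff ζ₂ ζ₁) : ℂ) • factor (conj ζ₁) w ζ₂ u₂ := by
  obtain ⟨r, hr, hw⟩ := h.exists_fast
  refine ⟨r, hr, ?_⟩
  -- The same argument for the adjoint identity at ζ₂, where the factors of soliton 2 have rank one.
  have h2 := h.factor_comm_conj ζ₂ u₂
  have hww : inner ℂ u₂ u₂ = 1 := by simp [inner_self_eq_norm_sq_to_K, h.norm_u₂]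
  have hs : ∀ u x : E, factor (conj ζ₂) u ζ₂ x = ((conj ζ₂ - ζ₂) * inner ℂ u x) • u := by
    intro u x
    simpa using factor_self_conj (conj ζ₂) u x
  rw [hs, hs, factor_smul, hww, mul_one, mul_smul] at h2
  have h3 := smul_right_injective E (sub_ne_zero.2 h₂.symm) h2
  have h4 : (r * conj (fastCoeff ζ₂ ζ₁) : ℂ) * inner ℂ v (factor (conj ζ₁) u ζ₂ u₂) = 1 := by
    rw [← hww]
    nth_rewrite 2 [hw]
    have := inner_factor_left ζ₁ u (conj ζ₂) v u₂
    rw [Complex.conj_conj] at this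
    rw [inner_smul_left, this]
    simp
  beta_reduce at h3
  rw [← h3, smul_smul, h4, one_smul]

end IsCollision

/-- The Yang-Baxter equation for the collision relation. -/
theorem IsCollision.yangBaxter {ζ₀ ζ₁ ζ₂ : ℂ} {x₀ x₁ x₂ y₀ y₁ y₂ y₀' y₁' y₂' z₀ z₁ z₂ z₀' z₁' z₂' : E}
    (h₁ : ζ₁ ≠ conj ζ₁)
    (a₁₂ : IsCollision ζ₁ ζ₂ x₁ x₂ y₁ y₂) (a₀₂ : IsCollision ζ₀ ζ₂ x₀ y₂ y₀ y₂')
    (a₀₁ : IsCollision ζ₀ ζ₁ y₀ y₁ y₀' y₁')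
    (b₀₁ : IsCollision ζ₀ ζ₁ x₀ x₁ z₀ z₁) (b₀₂ : IsCollision ζ₀ ζ₂ z₀ x₂ z₀' z₂)
    (b₁₂ : IsCollision ζ₁ ζ₂ z₁ z₂ z₁' z₂') :
    y₀' = z₀' ∧ y₁' = z₁' ∧ y₂' = z₂' := by
  -- Both vectors are the two factors of solitons 1 and 2, at ζ₀*, applied to x₀; only the order of
  -- these factors differs.
  have e₀ : y₀' = z₀' := by
    obtain ⟨r, hr, hr'⟩ := a₀₂.exists_fast
    obtain ⟨s, hs, hs'⟩ := a₀₁.exists_fast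
    obtain ⟨t, ht, ht'⟩ := b₀₁.exists_fast
    obtain ⟨k, hk, hk'⟩ := b₀₂.exists_fast
    refine eq_of_pos_smul a₀₁.norm_u₂ b₀₂.norm_u₂ (c := r * s / (t * k)) (by positivity) ?_
    rw [hs', hr', hk', ht', factor_smul, factor_smul, a₁₂.factor_comm, smul_smul, smul_smul,
      smul_smul]
    congr 1
    push_cast
    have : (t : ℂ) ≠ 0 := by exact_mod_cast ht.ne'
    have : (k : ℂ) ≠ 0 := by exact_mod_cast hk.ne'
    field_simp
  -- Likewise from x₂, with the adjoint factors of solitons 0 and 1 at ζ₂.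
  have e₂ : y₂' = z₂' := by
    obtain ⟨r, hr, hr'⟩ := a₁₂.exists_slow
    obtain ⟨s, hs, hs'⟩ := a₀₂.exists_slow
    obtain ⟨t, ht, ht'⟩ := b₀₂.exists_slow
    obtain ⟨k, hk, hk'⟩ := b₁₂.exists_slow
    refine eq_of_pos_smul a₀₂.norm_w b₁₂.norm_w (c := r * s / (t * k)) (by positivity) ?_
    rw [hs', hr', hk', ht', factor_smul, factor_smul, b₀₁.factor_comm_conj, smul_smul, smul_smul,
      smul_smul]
    congr 1
    push_cast
    have : (t : ℂ) ≠ 0 := by exact_mod_cast ht.ne'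
    have : (k : ℂ) ≠ 0 := by exact_mod_cast hk.ne'
    field_simp
  refine ⟨e₀, ?_, e₂⟩
  -- At ζ₁* both sides have rank at most one. Their image vectors F₂(x₂) x₁ and F₀(y₀') y₁' are both
  -- multiples of y₁, so comparing coefficients relates the covectors of F₀†(x₀) x₁ and F₂†(y₂')
  -- y₁'.
  have triple : ∀ x : E, factor ζ₂ x₂ (conj ζ₁) (factor ζ₁ x₁ (conj ζ₁) (factor ζ₀ x₀ (conj ζ₁) x)) =
      factor ζ₀ y₀' (conj ζ₁) (factor ζ₁ y₁' (conj ζ₁) (factor ζ₂ y₂' (conj ζ₁) x)) := by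
    intro x
    rw [a₁₂.factor_comm, a₀₂.factor_comm, a₀₁.factor_comm]
  obtain ⟨p, hp, hp'⟩ := a₁₂.exists_fast
  obtain ⟨q, hq, hq'⟩ := b₀₁.exists_slow
  obtain ⟨s, hs, hs'⟩ := a₀₁.exists_slow_inv h₁
  obtain ⟨t, ht, ht'⟩ := b₁₂.exists_fast_inv h₁
  have c₁ := fastCoeff_ne_zero a₁₂.ne a₁₂.ne_conj
  have c₂ := slowCoeff_ne_zero b₀₁.ne b₀₁.ne_conj
  refine eq_of_pos_smul a₀₁.norm_w b₁₂.norm_u₂ (c := t * s / (p * q)) (by positivity) ?_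
  have hy₁ : y₁ ≠ 0 := norm_ne_zero_iff.1 (by rw [a₁₂.norm_u₂]; exact one_ne_zero)
  have sub : ∀ (ζ : ℂ) (u x y : E), inner ℂ x (factor ζ u (conj ζ₁) y) =
      inner ℂ (factor (conj ζ) u ζ₁ x) y := by
    intro ζ u x y
    simpa using (inner_factor_left (conj ζ) u ζ₁ x y).symm
  -- It suffices to compare the images under F₂†(y₂'), which is invertible at ζ₁.
  refine factor_injective (u := y₂') (ζ := conj ζ₂) (lam := ζ₁) a₀₂.norm_w
    (fun e => a₁₂.ne_conj (by simp [e])) (by simpa using a₁₂.ne.symm) ?_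
  refine ext_inner_right ℂ fun x => ?_
  have h := triple x
  rw [factor_self_conj, factor_self_conj, factor_smul, factor_smul, sub, sub] at h
  have h' := congrArg (fun z => ((p * fastCoeff ζ₁ ζ₂) * (s * conj (slowCoeff ζ₀ ζ₁)) : ℂ) • z) h
  have hl : ∀ a b c : ℂ, ∀ z : E, (a * b) • c • z = (b * c) • a • z := by intros; module
  have hr : ∀ a b c : ℂ, ∀ z : E, (a * b) • c • z = (a * c) • b • z := by intros; module
  beta_reduce at h'
  rw [hl, ← hp', hr, ← hs'] at h'
  have h'' := smul_left_injective ℂ hy₁ h'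
  -- The other order of collisions gives two expressions for z₁: from x₁ forwards and from z₁'
  -- backwards. The equality y₂' = z₂' makes the factor the same as above.
  have hz : (q * conj (slowCoeff ζ₀ ζ₁)) * inner ℂ (factor (conj ζ₀) x₀ ζ₁ x₁) x =
      (t * fastCoeff ζ₁ ζ₂) * inner ℂ (factor (conj ζ₂) y₂' ζ₁ z₁') x := by
    have e := congrArg (fun z => inner ℂ z x) (hq'.symm.trans ht')
    simpa [inner_smul_left, e₂, mul_comm] using e
  have k : ζ₁ - conj ζ₁ ≠ 0 := sub_ne_zero.2 h₁
  have c₂' : conj (slowCoeff ζ₀ ζ₁) ≠ 0 := by simpa using c₂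
  have hp0 : (p : ℂ) ≠ 0 := by exact_mod_cast hp.ne'
  have hq0 : (q : ℂ) ≠ 0 := by exact_mod_cast hq.ne'
  have e : (p * q : ℂ) * inner ℂ (factor (conj ζ₂) y₂' ζ₁ y₁') x =
      (t * s) * inner ℂ (factor (conj ζ₂) y₂' ζ₁ z₁') x := by
    apply mul_left_cancel₀ (mul_ne_zero k (mul_ne_zero c₁ c₂'))
    linear_combination (-(q * conj (slowCoeff ζ₀ ζ₁)) : ℂ) * h'' +
      ((ζ₁ - conj ζ₁) * s * conj (slowCoeff ζ₀ ζ₁)) * hz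
  rw [factor_smul, inner_smul_left, Complex.conj_ofReal]
  push_cast
  field_simp
  linear_combination e
end Relation

variable {m : ℕ}

/-! ### Normalization of the explicit formulas -/

section Map

theorem ne_conj_of_im_pos {ζ₁ ζ₂ : ℂ} (h₁ : 0 < ζ₁.im) (h₂ : 0 < ζ₂.im) : ζ₁ ≠ conj ζ₂ := by
  intro h
  have := congrArg Complex.im h
  simp only [Complex.conj_im] at this
  linarith

theorem sub_conj_mul_sub_conj (ζ₁ ζ₂ : ℂ) :
    (ζ₁ - conj ζ₁) * (ζ₂ - conj ζ₂) = ((-4 * ζ₁.im * ζ₂.im : ℝ) : ℂ) := by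
  rw [Complex.sub_conj, Complex.sub_conj]
  push_cast
  linear_combination (4 * (ζ₁.im : ℂ) * ζ₂.im) * Complex.I_mul_I

theorem gram_eq_ofReal {E : Type*} [NormedAddCommGroup E] [InnerProductSpace ℂ E] (ζ₁ ζ₂ : ℂ)
    (u v : E) :
    gram ζ₁ ζ₂ u v = ((‖ζ₁ - ζ₂‖ ^ 2 + 4 * ζ₁.im * ζ₂.im * ‖inner ℂ v u‖ ^ 2 : ℝ) : ℂ) := by
  rw [gram, sub_conj_mul_sub_conj, ← map_sub, Complex.mul_conj', ← inner_conj_symm u v,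
    Complex.conj_mul']
  push_cast
  ring

theorem norm_smul_eq_one_of_gram {E : Type*} [NormedAddCommGroup E] [InnerProductSpace ℂ E]
    {b g : ℂ} {y : E} (hy : inner ℂ y y = g) (hb : b * conj b * g = 1) : ‖b • y‖ = 1 := by
  have h : inner ℂ (b • y) (b • y) = 1 := by
    rw [inner_smul_left, inner_smul_right, hy]
    linear_combination hb
  have h' : ‖b • y‖ ^ 2 = 1 := by
    rw [← inner_self_eq_norm_sq (𝕜 := ℂ), h]
    simp
  exact (pow_eq_one_iff_of_nonneg (norm_nonneg _) two_ne_zero).1 h'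

/-- The collision map is a collision in the sense of `IsCollision`. -/
theorem isCollision_collisionMap {ζ₁ ζ₂ : ℂ} (h₁ : 0 < ζ₁.im) (h₂ : 0 < ζ₂.im) (hne : ζ₁ ≠ ζ₂)
    {v u : Pol m} (hv : ‖v‖ = 1) (hu : ‖u‖ = 1) :
    IsCollision ζ₂ ζ₁ v u (collisionMap ζ₂ ζ₁ (v, u)).1 (collisionMap ζ₂ ζ₁ (v, u)).2 := by
  have hc : ζ₁ ≠ conj ζ₂ := ne_conj_of_im_pos h₁ h₂
  have n : ζ₁ - ζ₂ ≠ 0 := sub_ne_zero.2 hne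
  have n' : ζ₂ - ζ₁ ≠ 0 := sub_ne_zero.2 hne.symm
  have nc : conj ζ₁ - conj ζ₂ ≠ 0 := by simpa [← map_sub] using n
  have nc' : conj ζ₂ - conj ζ₁ ≠ 0 := by simpa [← map_sub] using n'
  have d : ζ₁ - conj ζ₂ ≠ 0 := sub_ne_zero.2 hc
  have dc : conj ζ₁ - ζ₂ ≠ 0 := by
    have := (map_ne_zero (starRingEnd ℂ)).2 d
    simpa using this
  have hgpos : 0 < ‖ζ₁ - ζ₂‖ ^ 2 + 4 * ζ₁.im * ζ₂.im * ‖inner ℂ v u‖ ^ 2 := by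
    have := norm_pos_iff.2 n
    positivity
  have hG := gram_eq_ofReal ζ₁ ζ₂ u v
  have hg0 : gram ζ₁ ζ₂ u v ≠ 0 := by rw [hG]; exact_mod_cast hgpos.ne'
  have hshift : initialShift ζ₁ ζ₂ u v = ‖(ζ₁ - ζ₂) / (ζ₁ - conj ζ₂)‖ ^ 2 *
      (‖ζ₁ - ζ₂‖ ^ 2 / (‖ζ₁ - ζ₂‖ ^ 2 + 4 * ζ₁.im * ζ₂.im * ‖inner ℂ v u‖ ^ 2)) := by
    rw [initialShift]
    congr 1
    have := norm_ne_zero_iff.2 n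
    rw [inv_eq_iff_eq_inv, inv_div]
    field_simp
    ring
  have hpos : 0 < initialShift ζ₁ ζ₂ u v := by
    rw [hshift]
    have := norm_pos_iff.2 n
    have := norm_pos_iff.2 (div_ne_zero n d)
    positivity
  -- Both constants have modulus |ζ₁ - ζ₂*| / |ζ₁ - ζ₂|², so this one identity normalizes both final
  -- polarizations.
  have hr2 : ((√(initialShift ζ₁ ζ₂ u v) : ℝ) : ℂ) ^ 2 * ((ζ₁ - conj ζ₂) * (conj ζ₁ - ζ₂)) *
      gram ζ₁ ζ₂ u v = ((ζ₁ - ζ₂) * (conj ζ₁ - conj ζ₂)) ^ 2 := by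
    rw [← Complex.ofReal_pow, Real.sq_sqrt hpos.le, hshift, norm_div, div_pow]
    have e₁ : (ζ₁ - conj ζ₂) * (conj ζ₁ - ζ₂) = ((‖ζ₁ - conj ζ₂‖ ^ 2 : ℝ) : ℂ) := by
      rw [Complex.ofReal_pow, ← Complex.mul_conj']
      simp
    have e₂ : (ζ₁ - ζ₂) * (conj ζ₁ - conj ζ₂) = ((‖ζ₁ - ζ₂‖ ^ 2 : ℝ) : ℂ) := by
      rw [Complex.ofReal_pow, ← Complex.mul_conj']
      simp
    rw [e₁, e₂, hG]
    norm_cast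
    have := norm_ne_zero_iff.2 d
    have := hgpos.ne'
    field_simp
  have hrpos : 0 < √(initialShift ζ₁ ζ₂ u v) := Real.sqrt_pos.2 hpos
  have hb : ((√(initialShift ζ₁ ζ₂ u v) : ℝ) * fastCoeff ζ₂ ζ₁ : ℂ) *
      conj ((√(initialShift ζ₁ ζ₂ u v) : ℝ) * fastCoeff ζ₂ ζ₁ : ℂ) * gram ζ₁ ζ₂ u v = 1 := by
    simp only [fastCoeff, map_mul, map_div₀, map_pow, map_sub, Complex.conj_conj,
      Complex.conj_ofReal]
    field_simp
    linear_combination hr2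
  have hs : ((√(initialShift ζ₁ ζ₂ u v) : ℝ) * slowCoeff ζ₂ ζ₁ : ℂ) *
      conj ((√(initialShift ζ₁ ζ₂ u v) : ℝ) * slowCoeff ζ₂ ζ₁ : ℂ) * gram ζ₁ ζ₂ u v = 1 := by
    simp only [slowCoeff, map_mul, map_div₀, map_pow, map_sub, Complex.conj_conj,
      Complex.conj_ofReal]
    field_simp
    linear_combination hr2
  have hf : (collisionMap ζ₂ ζ₁ (v, u)).1 = ((√(initialShift ζ₁ ζ₂ u v) : ℝ) * fastCoeff ζ₂ ζ₁ : ℂ) •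
      factor ζ₁ u (conj ζ₂) v := by
    simp only [collisionMap, fastCoeff, factor]
    match_scalars <;> field_simp
  have hw : (collisionMap ζ₂ ζ₁ (v, u)).2 = ((√(initialShift ζ₁ ζ₂ u v) : ℝ) * slowCoeff ζ₂ ζ₁ : ℂ) •
      factor (conj ζ₂) v ζ₁ u := by
    simp only [collisionMap, slowCoeff, factor, Complex.conj_conj]
    match_scalars <;> field_simp
    ring
  exact {
    ne := hne
    ne_conj := hc
    norm_v := hv
    norm_u := hu
    norm_u₂ := by rw [hf]; exact norm_smul_eq_one_of_gram (inner_factor_fast hu hv) hb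
    norm_w := by rw [hw]; exact norm_smul_eq_one_of_gram (inner_factor_slow hu hv) hs
    exists_fast := ⟨_, hrpos, hf⟩
    exists_slow := ⟨_, hrpos, hw⟩
    factor_comm := factor_comm hu hv hg0 hb hs hf hw }

/-- The dressed polarizations are unit vectors, positive multiples of explicit ones. -/
theorem dressed_eq {ζ₁ ζ₂ : ℂ} (h₁ : 0 < ζ₁.im) (h₂ : 0 < ζ₂.im) (hne : ζ₁ ≠ ζ₂)
    {u₁ u₂ : Pol m} (hu₁ : ‖u₁‖ = 1) (hu₂ : ‖u₂‖ = 1) :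
    ∃ r : ℝ, 0 < r ∧ ‖dressed ζ₁ ζ₂ u₁ u₂‖ = 1 ∧ dressed ζ₁ ζ₂ u₁ u₂ =
      (r * ((conj ζ₁ - conj ζ₂) / (ζ₁ - conj ζ₂) ^ 2) : ℂ) • factor (conj ζ₁) u₁ (conj ζ₂) u₂ := by
  have hc : ζ₁ ≠ conj ζ₂ := ne_conj_of_im_pos h₁ h₂
  have n : ζ₁ - ζ₂ ≠ 0 := sub_ne_zero.2 hne
  have nc : conj ζ₁ - conj ζ₂ ≠ 0 := by simpa [← map_sub] using n
  have d : ζ₁ - conj ζ₂ ≠ 0 := sub_ne_zero.2 hc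
  have dc : conj ζ₁ - ζ₂ ≠ 0 := by
    have := (map_ne_zero (starRingEnd ℂ)).2 d
    simpa using this
  have e₁ : (ζ₁ - conj ζ₂) * (conj ζ₁ - ζ₂) = ((‖ζ₁ - conj ζ₂‖ ^ 2 : ℝ) : ℂ) := by
    rw [Complex.ofReal_pow, ← Complex.mul_conj']
    simp
  have e₂ : (ζ₁ - ζ₂) * (conj ζ₁ - conj ζ₂) = ((‖ζ₁ - ζ₂‖ ^ 2 : ℝ) : ℂ) := by
    rw [Complex.ofReal_pow, ← Complex.mul_conj']
    simp
  have e₃ : ‖ζ₁ - conj ζ₂‖ ^ 2 = ‖ζ₁ - ζ₂‖ ^ 2 + 4 * ζ₁.im * ζ₂.im := by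
    have := sub_conj_mul_sub_conj ζ₁ ζ₂
    have h : ((‖ζ₁ - conj ζ₂‖ ^ 2 : ℝ) : ℂ) = ((‖ζ₁ - ζ₂‖ ^ 2 + 4 * ζ₁.im * ζ₂.im : ℝ) : ℂ) := by
      rw [← e₁]
      rw [Complex.ofReal_add, ← e₂]
      push_cast at this ⊢
      linear_combination -this
    exact_mod_cast h
  have ht : ‖inner ℂ u₂ u₁‖ ^ 2 ≤ 1 := by
    have := norm_inner_le_norm (𝕜 := ℂ) u₂ u₁
    rw [hu₁, hu₂, one_mul] at this
    exact pow_le_one₀ (norm_nonneg _) this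
  have hnpos := norm_pos_iff.2 n
  have hdpos := norm_pos_iff.2 d
  -- By Cauchy–Schwarz the expression is at least |ζ₁ - ζ₂*|² - 4 Im ζ₁ Im ζ₂ = |ζ₁ - ζ₂|².
  have hgpos : 0 < ‖ζ₁ - conj ζ₂‖ ^ 2 - 4 * ζ₁.im * ζ₂.im * ‖inner ℂ u₂ u₁‖ ^ 2 := by
    have : 0 < ζ₁.im * ζ₂.im := mul_pos h₁ h₂
    nlinarith [pow_pos hnpos 2]
  have hshift : bareShift ζ₁ ζ₂ u₁ u₂ = ‖ζ₁ - ζ₂‖ ^ 2 / ‖ζ₁ - conj ζ₂‖ ^ 4 *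
      (‖ζ₁ - conj ζ₂‖ ^ 2 - 4 * ζ₁.im * ζ₂.im * ‖inner ℂ u₂ u₁‖ ^ 2) := by
    rw [bareShift, norm_div]
    field_simp
    ring
  have hpos : 0 < bareShift ζ₁ ζ₂ u₁ u₂ := by
    rw [hshift]
    positivity
  have hrpos : 0 < (√(bareShift ζ₁ ζ₂ u₁ u₂))⁻¹ := inv_pos.2 (Real.sqrt_pos.2 hpos)
  have hf : dressed ζ₁ ζ₂ u₁ u₂ = (((√(bareShift ζ₁ ζ₂ u₁ u₂))⁻¹ : ℝ) *
      ((conj ζ₁ - conj ζ₂) / (ζ₁ - conj ζ₂) ^ 2) : ℂ) • factor (conj ζ₁) u₁ (conj ζ₂) u₂ := by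
    simp only [dressed, factor, Complex.conj_conj]
    match_scalars <;> field_simp
    ring
  refine ⟨_, hrpos, ?_, hf⟩
  rw [hf]
  have hs0 : ((√(bareShift ζ₁ ζ₂ u₁ u₂) : ℝ) : ℂ) ≠ 0 := by
    exact_mod_cast (Real.sqrt_pos.2 hpos).ne'
  have hself : inner ℂ (factor (conj ζ₁) u₁ (conj ζ₂) u₂) (factor (conj ζ₁) u₁ (conj ζ₂) u₂) =
      ((‖ζ₁ - conj ζ₂‖ ^ 2 - 4 * ζ₁.im * ζ₂.im * ‖inner ℂ u₂ u₁‖ ^ 2 : ℝ) : ℂ) := by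
    have h : inner ℂ u₁ u₁ = 1 := by simp [inner_self_eq_norm_sq_to_K, hu₁]
    have h' : inner ℂ u₂ u₂ = 1 := by simp [inner_self_eq_norm_sq_to_K, hu₂]
    have k := sub_conj_mul_sub_conj ζ₁ ζ₂
    have e := Complex.conj_mul' (inner ℂ u₂ u₁)
    rw [inner_conj_symm] at e
    rw [Complex.ofReal_sub, ← e₁]
    push_cast at k ⊢
    rw [← e]
    simp only [factor, inner_add_left, inner_add_right, inner_smul_left, inner_smul_right,
      map_sub, map_mul, Complex.conj_conj, inner_conj_symm, h, h']
    linear_combination (inner ℂ u₁ u₂ * inner ℂ u₂ u₁) * k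
  refine norm_smul_eq_one_of_gram hself ?_
  have hr2 : ((√(bareShift ζ₁ ζ₂ u₁ u₂) : ℝ) : ℂ) ^ 2 * ((ζ₁ - conj ζ₂) * (conj ζ₁ - ζ₂)) ^ 2 =
      (ζ₁ - ζ₂) * (conj ζ₁ - conj ζ₂) *
      ((‖ζ₁ - conj ζ₂‖ ^ 2 - 4 * ζ₁.im * ζ₂.im * ‖inner ℂ u₂ u₁‖ ^ 2 : ℝ) : ℂ) := by
    rw [← Complex.ofReal_pow, Real.sq_sqrt hpos.le, hshift, e₁, e₂]
    norm_cast
    field_simp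
  simp only [map_mul, map_div₀, map_inv₀, map_pow, map_sub, Complex.conj_conj,
    Complex.conj_ofReal, Complex.ofReal_inv]
  field_simp
  linear_combination -hr2

end Map

/-! ### Equivalence with the two-soliton collision law -/

section Law

theorem IsCollision.eq_dressed {ζ₁ ζ₂ : ℂ} (h₁ : 0 < ζ₁.im) (h₂ : 0 < ζ₂.im)
    {v u u₂ w : Pol m} (h : IsCollision ζ₂ ζ₁ v u u₂ w) :
    v = dressed ζ₁ ζ₂ u u₂ ∧ w = dressed ζ₂ ζ₁ u₂ u := by
  have n : ζ₁ - ζ₂ ≠ 0 := sub_ne_zero.2 h.ne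
  have nc : conj ζ₁ - conj ζ₂ ≠ 0 := by simpa [← map_sub] using n
  have nc' : conj ζ₂ - conj ζ₁ ≠ 0 := sub_ne_zero.2 (sub_ne_zero.1 nc).symm
  have d : ζ₁ - conj ζ₂ ≠ 0 := sub_ne_zero.2 h.ne_conj
  have d' : ζ₂ - conj ζ₁ ≠ 0 := sub_ne_zero.2 (ne_conj_of_im_pos h₂ h₁)
  constructor
  · obtain ⟨s, hs, hn, hs'⟩ := dressed_eq h₁ h₂ h.ne h.norm_u h.norm_u₂
    obtain ⟨r, hr, hr'⟩ := h.exists_fast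
    refine (eq_of_pos_smul hn h.norm_v (mul_pos hs hr) ?_).symm
    rw [hs']
    -- With u₂ expressed through v, the factor of soliton 1 meets its conjugate and leaves a scalar;
    -- all constants cancel except s r > 0.
    nth_rewrite 1 [hr']
    rw [factor_smul, factor_conj_factor h.norm_u, smul_smul, smul_smul]
    congr 1
    rw [fastCoeff]
    push_cast
    field_simp
  · obtain ⟨s, hs, hn, hs'⟩ := dressed_eq h₂ h₁ h.ne.symm h.norm_u₂ h.norm_u
    obtain ⟨r, hr, hr'⟩ := h.exists_slow_inv (ne_conj_of_im_pos h₁ h₁)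
    refine (eq_of_pos_smul hn h.norm_w (mul_pos hs hr) ?_).symm
    rw [hs']
    nth_rewrite 1 [hr']
    rw [factor_smul, factor_conj_factor h.norm_u₂, smul_smul, smul_smul]
    congr 1
    simp only [slowCoeff, map_div₀, map_pow, map_sub, Complex.conj_conj]
    push_cast
    field_simp

/-- Up to a positive scalar the map is an invertible linear factor. This gives the converse
direction of the collision law. -/
theorem dressed_injOn {ζ₁ ζ₂ : ℂ} (h₁ : 0 < ζ₁.im) (h₂ : 0 < ζ₂.im) (hne : ζ₁ ≠ ζ₂)
    {u : Pol m} (hu : ‖u‖ = 1) : Set.InjOn (dressed ζ₁ ζ₂ u) (unitSphere m) := by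
  intro x hx y hy h
  have n : ζ₁ - ζ₂ ≠ 0 := sub_ne_zero.2 hne
  have nc : conj ζ₁ - conj ζ₂ ≠ 0 := by simpa [← map_sub] using n
  have d : ζ₁ - conj ζ₂ ≠ 0 := sub_ne_zero.2 (ne_conj_of_im_pos h₁ h₂)
  obtain ⟨s, hs, -, hs'⟩ := dressed_eq h₁ h₂ hne hu hx
  obtain ⟨t, ht, -, ht'⟩ := dressed_eq h₁ h₂ hne hu hy
  rw [hs', ht', mul_comm (s : ℂ), mul_comm (t : ℂ), mul_smul, mul_smul] at h
  have h' := smul_right_injective _ (div_ne_zero nc (pow_ne_zero 2 d)) h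
  beta_reduce at h'
  rw [← factor_smul, ← factor_smul] at h'
  have h'' := factor_injective hu (fun e => nc (by rw [e, sub_self]))
    (by simpa using (sub_ne_zero.1 d).symm) h'
  refine eq_of_pos_smul hx hy (div_pos ht hs) ?_
  have : (s : ℂ) ≠ 0 := by exact_mod_cast hs.ne'
  push_cast
  rw [div_eq_inv_mul, mul_smul, ← h'', smul_smul, inv_mul_cancel₀ this, one_smul]

theorem collisionMap_mapsTo {ζ₁ ζ₂ : ℂ} (h₁ : 0 < ζ₁.im) (h₂ : 0 < ζ₂.im) (hne : ζ₁ ≠ ζ₂) :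
    Set.MapsTo (collisionMap ζ₂ ζ₁) (unitSphere m ×ˢ unitSphere m)
      (unitSphere m ×ˢ unitSphere m) := by
  rintro ⟨v, u⟩ ⟨hv, hu⟩
  have h := isCollision_collisionMap h₁ h₂ hne hv hu
  exact ⟨h.norm_u₂, h.norm_w⟩

theorem collisionMap_eq_iff {ζ₁ ζ₂ : ℂ} (h₁ : 0 < ζ₁.im) (h₂ : 0 < ζ₂.im) (hne : ζ₁ ≠ ζ₂)
    {v u u₂ : Pol m} (hv : v ∈ unitSphere m) (hu : u ∈ unitSphere m) (hu₂ : u₂ ∈ unitSphere m)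
    (w : Pol m) :
    collisionMap ζ₂ ζ₁ (v, u) = (u₂, w) ↔ v = dressed ζ₁ ζ₂ u u₂ ∧ w = dressed ζ₂ ζ₁ u₂ u := by
  have h := isCollision_collisionMap h₁ h₂ hne hv hu
  obtain ⟨e₁, e₂⟩ := h.eq_dressed h₁ h₂
  constructor
  · intro e
    rw [e] at e₁ e₂
    exact ⟨e₁, e₂⟩
  · rintro ⟨e, rfl⟩
    have := dressed_injOn h₁ h₂ hne hu h.norm_u₂ hu₂ (e₁.symm.trans e)
    rw [this] at e₂
    exact Prod.ext this e₂

end Law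

/-! ### Collisions acting on states of N solitons -/

section Pair
variable {N : ℕ} {ζ : Fin N → ℂ}

theorem pairCollision_fst {i j : Fin N} (h : i ≠ j) (x : Fin N → Pol m) :
    pairCollision ζ i j x i = (collisionMap (ζ i) (ζ j) (x i, x j)).1 := by
  simp [pairCollision, h]

theorem pairCollision_snd (i j : Fin N) (x : Fin N → Pol m) :
    pairCollision ζ i j x j = (collisionMap (ζ i) (ζ j) (x i, x j)).2 := by
  simp [pairCollision]

theorem pairCollision_of_ne {i j k : Fin N} (hi : k ≠ i) (hj : k ≠ j) (x : Fin N → Pol m) :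
    pairCollision ζ i j x k = x k := by
  simp [pairCollision, hi, hj]

theorem isCollision_pairCollision (hζ : ∀ n, 0 < (ζ n).im) (hinj : Function.Injective ζ)
    {i j : Fin N} (h : i ≠ j) {x : Fin N → Pol m} (hx : x ∈ unitStates N m) :
    IsCollision (ζ i) (ζ j) (x i) (x j) (pairCollision ζ i j x i) (pairCollision ζ i j x j) := by
  rw [pairCollision_fst h, pairCollision_snd]
  exact isCollision_collisionMap (hζ j) (hζ i) (hinj.ne h.symm) (hx i) (hx j)

theorem pairCollision_mem (hζ : ∀ n, 0 < (ζ n).im) (hinj : Function.Injective ζ)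
    {i j : Fin N} (h : i ≠ j) {x : Fin N → Pol m} (hx : x ∈ unitStates N m) :
    pairCollision ζ i j x ∈ unitStates N m := by
  have hc := isCollision_pairCollision hζ hinj h hx
  intro k
  by_cases hi : k = i
  · exact hi ▸ hc.norm_u₂
  by_cases hj : k = j
  · exact hj ▸ hc.norm_w
  rw [pairCollision_of_ne hi hj]
  exact hx k

theorem pairCollision_yangBaxter (hζ : ∀ n, 0 < (ζ n).im) (hinj : Function.Injective ζ)
    {i j k : Fin N} (hij : i ≠ j) (hik : i ≠ k) (hjk : j ≠ k) {x : Fin N → Pol m}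
    (hx : x ∈ unitStates N m) :
    pairCollision ζ i j (pairCollision ζ i k (pairCollision ζ j k x)) =
      pairCollision ζ j k (pairCollision ζ i k (pairCollision ζ i j x)) := by
  have hxa := pairCollision_mem hζ hinj hjk hx
  have hxa' := pairCollision_mem hζ hinj hik hxa
  have hxb := pairCollision_mem hζ hinj hij hx
  have hxb' := pairCollision_mem hζ hinj hik hxb
  have a₁ := isCollision_pairCollision hζ hinj hjk hx
  have a₂ := isCollision_pairCollision hζ hinj hik hxa
  have a₃ := isCollision_pairCollision hζ hinj hij hxa'
  have b₁ := isCollision_pairCollision hζ hinj hij hx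
  have b₂ := isCollision_pairCollision hζ hinj hik hxb
  have b₃ := isCollision_pairCollision hζ hinj hjk hxb'
  rw [pairCollision_of_ne hij hik] at a₂
  rw [pairCollision_of_ne hij.symm hjk] at a₃
  rw [pairCollision_of_ne hik.symm hjk.symm] at b₂
  rw [pairCollision_of_ne hij.symm hjk] at b₃
  obtain ⟨e₀, e₁, e₂⟩ := IsCollision.yangBaxter (ne_conj_of_im_pos (hζ j) (hζ j)) a₁ a₂ a₃ b₁ b₂ b₃
  funext n
  by_cases hi : n = i
  · rw [hi, e₀, pairCollision_of_ne hij hik]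
  by_cases hj : n = j
  · rw [hj, e₁]
  by_cases hk : n = k
  · rw [hk, ← e₂, pairCollision_of_ne hik.symm hjk.symm]
  rw [pairCollision_of_ne hi hj, pairCollision_of_ne hi hk, pairCollision_of_ne hj hk,
    pairCollision_of_ne hj hk, pairCollision_of_ne hi hk, pairCollision_of_ne hi hj]

theorem pairCollision_comm {i j k l : Fin N} (hik : i ≠ k) (hil : i ≠ l) (hjk : j ≠ k)
    (hjl : j ≠ l) (x : Fin N → Pol m) :
    pairCollision ζ i j (pairCollision ζ k l x) = pairCollision ζ k l (pairCollision ζ i j x) := by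
  funext n
  simp only [pairCollision, Function.update_apply]
  split_ifs <;> simp_all
end Pair

/-! ### Sorting by adjacent transpositions and independence of the order -/

section Sorting
variable {N : ℕ}

/-- The number of inversions of a list. -/
def inversions : List (Fin N) → ℕ
  | [] => 0
  | a :: l => l.countP (· < a) + inversions l

/-- Only the relative order of the two exchanged neighbours changes. -/
theorem inversions_swap (l₁ l₂ : List (Fin N)) {j k : Fin N} (h : j < k) :
    inversions (l₁ ++ k :: j :: l₂) = inversions (l₁ ++ j :: k :: l₂) + 1 := by
  induction l₁ with
  | nil => simp [inversions, h, h.not_gt]; omega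
  | cons a l ih =>
    simp only [List.cons_append, inversions, ih, List.countP_append, List.countP_cons]
    omega

theorem inversions_eq_zero {l : List (Fin N)} (h : l.Pairwise (· < ·)) : inversions l = 0 := by
  induction l with
  | nil => rfl
  | cons a l ih =>
    rw [List.pairwise_cons] at h
    rw [inversions, ih h.2, List.countP_eq_zero.2]
    intro b hb
    simpa using (h.1 b hb).le

theorem inversions_of_pairwise_gt {l : List (Fin N)} (h : l.Pairwise (· > ·)) :
    inversions l = l.length.choose 2 := by
  induction l with
  | nil => rfl
  | cons a l ih =>
    rw [List.pairwise_cons] at h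
    rw [inversions, ih h.2, List.countP_eq_length.2 (by simpa using h.1), List.length_cons,
      Nat.choose_succ_succ' _ 1, Nat.choose_one_right]

theorem Collide.length_eq {a b : List (Fin N)} {w : List (Fin N × Fin N)} (h : Collide a w b)  :
    inversions a = inversions b + w.length := by
  induction h with
  | nil => simp
  | cons l₁ l₂ j k w b hjk _ ih =>
    rw [inversions_swap l₁ l₂ hjk, ih, List.length_cons]
    omega

theorem exists_descent {l : List (Fin N)} (hn : l.Nodup) (h : ¬ l.Pairwise (· < ·)) :
    ∃ (l₁ l₂ : List (Fin N)) (j k : Fin N), j < k ∧ l = l₁ ++ k :: j :: l₂ := by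
  induction l with
  | nil => simp at h
  | cons a l ih =>
    rw [List.nodup_cons] at hn
    by_cases hl : l.Pairwise (· < ·)
    · cases l with
      | nil => simp at h
      | cons b l =>
        refine ⟨[], l, b, a, ?_, rfl⟩
        by_contra hab
        have hab : a < b := lt_of_le_of_ne (not_lt.1 hab) (fun e => hn.1 (by simp [e]))
        refine h (List.pairwise_cons.2 ⟨fun c hc => ?_, hl⟩)
        rcases List.mem_cons.1 hc with rfl | hc
        · exact hab
        · exact hab.trans ((List.pairwise_cons.1 hl).1 c hc)
    · obtain ⟨l₁, l₂, j, k, hjk, rfl⟩ := ih hn.2 hl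
      exact ⟨a :: l₁, l₂, j, k, hjk, rfl⟩

/-- An unsorted arrangement has a descent, and a collision there lowers the inversion number. The
lemma supplies the common continuation when two orders are joined. -/
theorem exists_collide {a b : List (Fin N)} (hb : b.Pairwise (· < ·)) (hab : a.Perm b) :
    ∃ w, Collide a w b := by
  induction hn : inversions a using Nat.strong_induction_on generalizing a with
  | _ n ih =>
    have hnb : b.Nodup := hb.imp fun h => h.ne
    by_cases ha : a.Pairwise (· < ·)
    · rw [hab.eq_of_pairwise (fun _ _ _ _ h h' => absurd h' h.not_gt) ha hb]
      exact ⟨[], .nil _⟩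
    · obtain ⟨l₁, l₂, j, k, hjk, rfl⟩ := exists_descent (hab.nodup_iff.2 hnb) ha
      have hp : (l₁ ++ j :: k :: l₂).Perm b :=
        ((List.Perm.swap k j l₂).append_left l₁).trans hab
      obtain ⟨w, hw⟩ := ih _ (by rw [← hn, inversions_swap l₁ l₂ hjk]; omega) hp rfl
      exact ⟨_, .cons _ _ _ _ _ _ hjk hw⟩

theorem composite_cons {ζ : Fin N → ℂ} (p : Fin N × Fin N) (w : List (Fin N × Fin N))
    (x : Fin N → Pol m) : composite ζ (p :: w) x = composite ζ w (pairCollision ζ p.1 p.2 x) := rfl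

/-- Two ways of splitting a list at a pair of neighbours, the first one not to the right of the
second one: the pairs coincide, overlap or are disjoint. -/
theorem split_cases {α : Type*} {l₁ l₂ l₁' l₂' : List α} {a b a' b' : α}
    (h : l₁ ++ a :: b :: l₂ = l₁' ++ a' :: b' :: l₂') (hl : l₁.length ≤ l₁'.length) :
    (l₁ = l₁' ∧ a = a' ∧ b = b' ∧ l₂ = l₂') ∨
    (l₁' = l₁ ++ [a] ∧ a' = b ∧ l₂ = b' :: l₂') ∨
    ∃ l, l₁' = l₁ ++ a :: b :: l ∧ l₂ = l ++ a' :: b' :: l₂' := by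
  induction l₁ generalizing l₁' with
  | nil =>
    rcases l₁' with _ | ⟨c, _ | ⟨d, l⟩⟩ <;> simp_all
  | cons c l₁ ih =>
    cases l₁' with
    | nil => simp at hl
    | cons d l₁' =>
      simp only [List.cons_append, List.cons.injEq] at h
      simp only [List.length_cons, Nat.add_le_add_iff_right] at hl
      obtain ⟨rfl, h⟩ := h
      rcases ih h hl with ⟨rfl, h'⟩ | ⟨rfl, h'⟩ | ⟨l, rfl, h'⟩
      · exact .inl ⟨rfl, h'⟩
      · exact .inr (.inl ⟨rfl, h'⟩)
      · exact .inr (.inr ⟨l, rfl, h'⟩)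

/-- Confluence by strong induction on inversions: after different first collisions, both orders are
replaced, by the induction hypothesis, with continuations through a common arrangement. -/
theorem composite_eq {ζ : Fin N → ℂ} (hζ : ∀ n, 0 < (ζ n).im) (hinj : Function.Injective ζ)
    {a b : List (Fin N)} (hb : b.Pairwise (· < ·)) (hab : a.Perm b)
    {w w' : List (Fin N × Fin N)} (hw : Collide a w b) (hw' : Collide a w' b)
    {x : Fin N → Pol m} (hx : x ∈ unitStates N m) : composite ζ w x = composite ζ w' x := by
  induction hn : inversions a using Nat.strong_induction_on generalizing a w w' x with
  | _ n ih =>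
    have hnd : a.Nodup := hab.nodup_iff.2 (hb.imp fun h => h.ne)
    have key : ∀ (l₁ l₂ : List (Fin N)) (j k : Fin N) (v : List (Fin N × Fin N))
        (l₁' l₂' : List (Fin N)) (j' k' : Fin N) (v' : List (Fin N × Fin N)),
        j < k → Collide (l₁ ++ j :: k :: l₂) v b → a = l₁ ++ k :: j :: l₂ →
        j' < k' → Collide (l₁' ++ j' :: k' :: l₂') v' b → a = l₁' ++ k' :: j' :: l₂' →
        l₁.length ≤ l₁'.length →
        composite ζ v (pairCollision ζ k j x) = composite ζ v' (pairCollision ζ k' j' x) := by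
      intro l₁ l₂ j k v l₁' l₂' j' k' v' hjk hv ha hjk' hv' ha' hl
      have hy := pairCollision_mem hζ hinj hjk.ne' hx
      have hy' := pairCollision_mem hζ hinj hjk'.ne' hx
      have i₁ := inversions_swap l₁ l₂ hjk
      have i₂ := inversions_swap l₁' l₂' hjk'
      rw [← ha] at i₁
      rw [← ha'] at i₂
      have p₁ : (l₁ ++ j :: k :: l₂).Perm b :=
        ((List.Perm.swap k j l₂).append_left l₁).trans (ha ▸ hab)
      have p₂ : (l₁' ++ j' :: k' :: l₂').Perm b :=
        ((List.Perm.swap k' j' l₂').append_left l₁').trans (ha' ▸ hab)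
      rcases split_cases (ha.symm.trans ha') hl with
        ⟨rfl, rfl, rfl, rfl⟩ | ⟨rfl, rfl, rfl⟩ | ⟨l, rfl, rfl⟩
      · exact ih _ (by omega) p₁ hv hv' hy rfl
      -- Overlap: three neighbours k, k', j' with j' < k' < k. Both first collisions can be
      -- continued to j', k', k, and the two ways around the hexagon are the sides of the
      -- Yang–Baxter equation.
      · have q : (l₁ ++ j' :: k' :: k :: l₂').Perm b :=
          (((List.Perm.swap k' j' (k :: l₂')).trans
            ((List.Perm.swap k j' l₂').cons k')).append_left l₁).trans p₁
        obtain ⟨s, hs⟩ := exists_collide hb q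
        have c₁ : Collide (l₁ ++ k' :: k :: j' :: l₂') ((k, j') :: (k', j') :: s) b := by
          have h := Collide.cons (l₁ ++ [k']) l₂' j' k ((k', j') :: s) b (hjk'.trans hjk)
          simp only [List.append_assoc, List.cons_append, List.nil_append] at h
          exact h (.cons l₁ (k :: l₂') j' k' s b hjk' hs)
        have c₂ : Collide (l₁ ++ [k] ++ j' :: k' :: l₂') ((k, j') :: (k, k') :: s) b := by
          have h := Collide.cons (l₁ ++ [j']) l₂' k' k s b hjk
          simp only [List.append_assoc, List.cons_append, List.nil_append] at h ⊢
          exact .cons l₁ (k' :: l₂') j' k _ b (hjk'.trans hjk) (h hs)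
        rw [ih _ (by omega) p₁ hv c₁ hy rfl, ih _ (by omega) p₂ hv' c₂ hy' rfl]
        simp only [composite_cons]
        rw [pairCollision_yangBaxter hζ hinj hjk.ne' (hjk'.trans hjk).ne' hjk'.ne' hx]
      -- Disjoint pairs: each order next performs the other collision, and the two maps commute
      -- because the four solitons are distinct.
      · have q : (l₁ ++ j :: k :: (l ++ j' :: k' :: l₂')).Perm b :=
          (((((List.Perm.swap k' j' l₂').append_left l).cons k).cons j).append_left l₁).trans p₁
        obtain ⟨s, hs⟩ := exists_collide hb q
        have c₁ : Collide (l₁ ++ j :: k :: (l ++ k' :: j' :: l₂')) ((k', j') :: s) b := by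
          have h := Collide.cons (l₁ ++ j :: k :: l) l₂' j' k' s b hjk'
          simp only [List.append_assoc, List.cons_append] at h
          exact h hs
        have c₂ : Collide (l₁ ++ k :: j :: l ++ j' :: k' :: l₂') ((k, j) :: s) b := by
          simp only [List.append_assoc, List.cons_append]
          exact .cons l₁ _ j k s b hjk hs
        rw [ih _ (by omega) p₁ hv c₁ hy rfl, ih _ (by omega) p₂ hv' c₂ hy' rfl]
        simp only [composite_cons]
        rw [ha] at hnd
        simp only [List.nodup_append, List.nodup_cons, List.mem_cons, List.mem_append,
          not_or] at hnd
        obtain ⟨-, ⟨⟨-, -, h₁, h₂, -⟩, ⟨-, h₃, h₄, -⟩, -⟩, -⟩ := hnd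
        rw [pairCollision_comm (Ne.symm h₁) (Ne.symm h₃) (Ne.symm h₂) (Ne.symm h₄)]
    have hlen := hw.length_eq.symm.trans hw'.length_eq
    generalize ha : a = a' at hw'
    cases hw with
    | nil =>
      have : w' = [] := List.length_eq_zero_iff.1 (by simpa using hlen.symm)
      rw [this]
    | cons l₁ l₂ j k v _ hjk hv =>
    cases hw' with
    | nil => simp at hlen
    | cons l₁' l₂' j' k' v' _ hjk' hv' =>
    simp only [composite_cons]
    -- The situation is symmetric in the two orders, so the first collision further left may be
    -- taken first.
    rcases le_total l₁.length l₁'.length with hl | hl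
    · exact key l₁ l₂ j k v l₁' l₂' j' k' v' hjk hv rfl hjk' hv' ha hl
    · exact (key l₁' l₂' j' k' v' l₁ l₂ j k v hjk' hv' ha hjk hv rfl hl).symm
end Sorting

end Manakov

end

theorem mainTheorem7 (m : ℕ) :
    -- the collision map is a map of pairs of unit vectors, and it is the passage from the initial
    -- to the final polarizations in the two-soliton collision law
    (∀ ζ₁ ζ₂ : ℂ, 0 < ζ₁.im → 0 < ζ₂.im → ζ₁ ≠ ζ₂ →
      Set.MapsTo (Manakov.collisionMap ζ₂ ζ₁)
        (Manakov.unitSphere m ×ˢ Manakov.unitSphere m)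
        (Manakov.unitSphere m ×ˢ Manakov.unitSphere m) ∧
      ∀ v ∈ Manakov.unitSphere m, ∀ u₁ ∈ Manakov.unitSphere m, ∀ u₂ ∈ Manakov.unitSphere m,
        ∀ w : Manakov.Pol m,
          (Manakov.collisionMap ζ₂ ζ₁ (v, u₁) = (u₂, w) ↔
            v = Manakov.dressed ζ₁ ζ₂ u₁ u₂ ∧ w = Manakov.dressed ζ₂ ζ₁ u₂ u₁)) ∧
    -- the parameter-dependent set-theoretic Yang-Baxter equation
    (∀ ζ : Fin 3 → ℂ, (∀ i, 0 < (ζ i).im) → Function.Injective ζ →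
      Set.EqOn
        (Manakov.pairCollision ζ 0 1 ∘ Manakov.pairCollision ζ 0 2 ∘ Manakov.pairCollision ζ 1 2)
        (Manakov.pairCollision ζ 1 2 ∘ Manakov.pairCollision ζ 0 2 ∘ Manakov.pairCollision ζ 0 1)
        (Manakov.unitStates 3 m)) ∧
    -- for `N` solitons, every admissible order of the pair collisions has the same composite
    (∀ (N : ℕ) (ζ : Fin N → ℂ), (∀ n, 0 < (ζ n).im) → StrictAnti (fun n => (ζ n).re) →
      (∀ w : List (Fin N × Fin N), Manakov.IsAdmissibleOrder N w → w.length = N.choose 2) ∧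
      ∀ w w' : List (Fin N × Fin N),
        Manakov.IsAdmissibleOrder N w → Manakov.IsAdmissibleOrder N w' →
          Set.EqOn (Manakov.composite ζ w) (Manakov.composite ζ w') (Manakov.unitStates N m)) := by
  refine ⟨fun ζ₁ ζ₂ h₁ h₂ hne => ⟨Manakov.collisionMap_mapsTo h₁ h₂ hne,
    fun v hv u hu u₂ hu₂ w => Manakov.collisionMap_eq_iff h₁ h₂ hne hv hu hu₂ w⟩, ?_, ?_⟩
  · intro ζ hζ hinj x hx
    exact Manakov.pairCollision_yangBaxter hζ hinj (by decide) (by decide) (by decide) hx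
  · intro N ζ hζ hanti
    have hinj : Function.Injective ζ := fun i j h => hanti.injective (congrArg Complex.re h)
    have hsort : (List.finRange N).Pairwise (· < ·) := List.pairwise_lt_finRange N
    refine ⟨fun w hw => ?_, fun w w' hw hw' x hx =>
      Manakov.composite_eq hζ hinj hsort (List.reverse_perm _) hw hw' hx⟩
    have h := Manakov.Collide.length_eq hw
    rw [Manakov.inversions_eq_zero hsort, zero_add, Manakov.inversions_of_pairwise_gt
      (List.pairwise_reverse.2 hsort), List.length_reverse, List.length_finRange] at h
    exact h.symm
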